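/- Let $M$ be a smooth manifold and $L\to M$ a smooth real line bundle. Let $DL$ be its Atiyah algebroid: sections of $DL$ are the derivations of $L$, i.e. the $\mathbb R$-linear operators $\Delta:\Gamma(L)\to\Gamma(L)$ for which there is a vector field $X$ with $\Delta(f\lambda)=X(f)\lambda+f\Delta(\lambda)$ for all $f\in C^\infty(M)$, $\lambda\in\Gamma(L)$; the bracket is the commutator. Let $J^1L=(DL)^*\otimes L$, with $L$-valued duality pairing $\langle-,-\rangle_L$, let $d_{DL}$ be the de Rham differential of $DL$ with coefficients in $L$ on $L$-valued Atiyah forms (sections of $\wedge^\bullet(DL)^*\otimes L$), and let $\mathcal L_\Delta$ be the Lie derivative along $\Delta$. On $\mathbb DL=DL\oplus J^1L$ consider the pairing $\langle\langle(\Delta,\phi),(\nabla,\psi)\rangle\rangle=\langle\Delta,\psi\rangle_L+\langle\nabla,\phi\rangle_L$ and the Dorfman–Jacobi bracket $[\![(\Delta,\phi),(\nabla,\psi)]\!]=([\Delta,\nabla],\ \mathcal L_\Delta\psi-i_\nabla d_{DL}\phi)$. Let $\mathcal I:\mathbb DL\to\mathbb DL$ be a generalized almost contact structure, i.e. a vector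 bundle endomorphism with $\mathcal I^2=-\mathrm{id}$ and $\mathcal I^\dagger=-\mathcal I$ (the adjoint with respect to $\langle\langle-,-\rangle\rangle$), and write it as $\mathcal I(\Delta,\psi)=(\varphi\Delta+J^\sharp\psi,\ \omega^\flat\Delta-\varphi^\dagger\psi)$, where $\varphi$ is an endomorphism of $DL$ with adjoint $\varphi^\dagger:J^1L\to J^1L$, $\langle\Delta,\varphi^\dagger\psi\rangle_L=\langle\varphi\Delta,\psi\rangle_L$, and where $J(\phi,\psi)=\langle J^\sharp\phi,\psi\rangle_L$ and $\omega(\Delta,\nabla)=\langle\nabla,\omega^\flat\Delta\rangle_L$ are $L$-valued alternating $2$-forms on $J^1L$ and on $DL$. Put $\omega_\varphi(\Delta,\nabla)=\omega(\varphi\Delta,\nabla)$ (an Atiyah $2$-form), $$[\phi,\psi]_J=\mathcal L_{J^\sharp\phi}\psi-\mathcal L_{J^\sharp\psi}\phi-d_{DL}\,J(\phi,\psi),$$ $$\mathcal N_\varphi(\Delta,\nabla)=[\varphi\Delta,\varphi\nabla]+\varphi^2[\Delta,\nabla]-\varphi[\varphi\Delta,\nabla]-\varphi[\Delta,\varphi\nabla].$$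 Then $\mathcal I$ is integrable, i.e. its Nijenhuis torsion $$\mathcal N_{\mathcal I}(\alpha,\beta)=[\![\mathcal I\alpha,\mathcal I\beta]\!]-[\![\alpha,\beta]\!]-\mathcal I[\![\mathcal I\alpha,\beta]\!]-\mathcal I[\![\alpha,\mathcal I\beta]\!]$$ vanishes for all $\alpha,\beta\in\Gamma(\mathbb DL)$, if and only if for all $\phi,\psi\in\Gamma(J^1L)$ and $\Delta,\nabla,\square\in\Gamma(DL)$ the following four conditions hold: (C1) $J^\sharp[\phi,\psi]_J=[J^\sharp\phi,J^\sharp\psi]$; (C2) $\varphi^\dagger[\phi,\psi]_J=\mathcal L_{J^\sharp\phi}\varphi^\dagger\psi-\mathcal L_{J^\sharp\psi}\varphi^\dagger\phi-d_{DL}\,J(\varphi^\dagger\phi,\psi)$; (C3) $\mathcal N_\varphi(\Delta,\nabla)=J^\sharp\big((d_{DL}\omega)(\Delta,\nabla,-)\big)$; (C4) $(d_{DL}\omega_\varphi)(\Delta,\nabla,\square)=(d_{DL}\omega)(\varphi\Delta,\nabla,\square)+(d_{DL}\omega)(\Delta,\varphi\nabla,\square)+(d_{DL}\omega)(\Delta,\nabla,\varphi\square)$.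 -/

import Mathlib

open scoped Manifold ContDiff Bundle

set_option linter.unusedSectionVars false

noncomputable section
namespace GeneralizedContact

section Fields
variable {E : Type*} [NormedAddCommGroup E] [NormedSpace ℝ E]
  {M : Type*} [TopologicalSpace M] [ChartedSpace E M]

variable (E M) in
/-- The algebra `C^∞(M)`. -/
abbrev SmoothFn : Type _ := C^∞⟮𝓘(ℝ, E), M; 𝓘(ℝ, ℝ), ℝ⟯

variable (E M) in
/-- Smooth vector fields on `M`. -/
abbrev VField [IsManifold 𝓘(ℝ, E) ∞ M] : Type _ :=
  Cₛ^∞⟮𝓘(ℝ, E); E, (TangentSpace 𝓘(ℝ, E) : M → Type _)⟯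

theorem contMDiff_dir [IsManifold 𝓘(ℝ, E) ∞ M] (X : VField E M) (f : SmoothFn E M) :
    ContMDiff 𝓘(ℝ, E) 𝓘(ℝ, ℝ) ∞ (fun x => mvfderiv 𝓘(ℝ, E) f x (X x)) := by
  have h1 := f.contMDiff.contMDiff_tangentMap (m := ∞) (by simp)
  have h2 := h1.comp X.contMDiff
  exact (contMDiff_snd_tangentBundle_modelSpace ℝ 𝓘(ℝ, ℝ)).comp h2

/-- The derivative `X(f)` of a smooth function along a smooth vector field. -/
def VField.app [IsManifold 𝓘(ℝ, E) ∞ M] (X : VField E M) (f : SmoothFn E M) : SmoothFn E M :=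
  ⟨fun x => mvfderiv 𝓘(ℝ, E) f x (X x), contMDiff_dir X f⟩

theorem isManifold_two [IsManifold 𝓘(ℝ, E) ∞ M] : IsManifold 𝓘(ℝ, E) (minSmoothness ℝ 2) M :=
  IsManifold.of_le (n := ∞) (by
    simp only [minSmoothness_of_isRCLikeNormedField]; exact WithTop.coe_le_coe.2 le_top)

theorem isManifold_three [IsManifold 𝓘(ℝ, E) ∞ M] : IsManifold 𝓘(ℝ, E) (minSmoothness ℝ 3) M :=
  IsManifold.of_le (n := ∞) (by
    simp only [minSmoothness_of_isRCLikeNormedField]; exact WithTop.coe_le_coe.2 le_top)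

theorem contMDiffAt_bracket [CompleteSpace E] [IsManifold 𝓘(ℝ, E) ∞ M]
    {V W : (x : M) → TangentSpace 𝓘(ℝ, E) x} {x : M}
    (hV : ContMDiffAt 𝓘(ℝ, E) 𝓘(ℝ, E).tangent ∞
      (fun y => (⟨y, V y⟩ : TangentBundle 𝓘(ℝ, E) M)) x)
    (hW : ContMDiffAt 𝓘(ℝ, E) 𝓘(ℝ, E).tangent ∞
      (fun y => (⟨y, W y⟩ : TangentBundle 𝓘(ℝ, E) M)) x) :
    ContMDiffAt 𝓘(ℝ, E) 𝓘(ℝ, E).tangent ∞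
      (fun y => (⟨y, VectorField.mlieBracket 𝓘(ℝ, E) V W y⟩ : TangentBundle 𝓘(ℝ, E) M)) x := by
  have := isManifold_two (E := E) (M := M)
  have : IsManifold 𝓘(ℝ, E) (((⊤ : ℕ∞) : WithTop ℕ∞) + 1) M :=
    IsManifold.of_le (n := ∞) (by simp)
  exact ContMDiffAt.mlieBracket_vectorField (m := ⊤) (n := ⊤) hV hW (by simp)

theorem bracket_bracket_smul [CompleteSpace E] [IsManifold 𝓘(ℝ, E) ∞ M]
    (X Y : VField E M) (f : SmoothFn E M) {U : (x : M) → TangentSpace 𝓘(ℝ, E) x} {x : M}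
    (hU : ContMDiffAt 𝓘(ℝ, E) 𝓘(ℝ, E).tangent ∞
      (fun y => (⟨y, U y⟩ : TangentBundle 𝓘(ℝ, E) M)) x) :
    VectorField.mlieBracket 𝓘(ℝ, E) X (VectorField.mlieBracket 𝓘(ℝ, E) Y ((f : M → ℝ) • U)) x =
      X.app (Y.app f) x • U x + Y.app f x • VectorField.mlieBracket 𝓘(ℝ, E) X U x
      + (X.app f x • VectorField.mlieBracket 𝓘(ℝ, E) Y U x
        + f x • VectorField.mlieBracket 𝓘(ℝ, E) X (VectorField.mlieBracket 𝓘(ℝ, E) Y U) x) := by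
  have := isManifold_two (E := E) (M := M)
  have hev : ∀ᶠ y in nhds x, MDifferentiableAt 𝓘(ℝ, E) 𝓘(ℝ, E).tangent
      (fun y => (⟨y, U y⟩ : TangentBundle 𝓘(ℝ, E) M)) y := by
    filter_upwards [(contMDiffAt_iff_contMDiffAt_nhds (n := 1) (by simp)).1 (hU.of_le (m := 1) (by simp))] with y hy
    exact hy.mdifferentiableAt (by simp)
  have hf : ∀ g : SmoothFn E M, ∀ y, MDifferentiableAt 𝓘(ℝ, E) 𝓘(ℝ, ℝ) g y := fun g y =>
    g.contMDiff.contMDiffAt.mdifferentiableAt (by simp)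
  have hYU := contMDiffAt_bracket Y.contMDiff.contMDiffAt hU
  have hYU' := hYU.mdifferentiableAt (by simp)
  have e1 : VectorField.mlieBracket 𝓘(ℝ, E) Y ((f : M → ℝ) • U) =ᶠ[nhds x]
      ((Y.app f : M → ℝ) • U + (f : M → ℝ) • VectorField.mlieBracket 𝓘(ℝ, E) Y U) := by
    filter_upwards [hev] with y hy
    rw [VectorField.mlieBracket_smul_right (hf f y) hy]
    rfl
  refine (Filter.EventuallyEq.mlieBracket_vectorField_eq (V₁ := X) (V := X)
    Filter.EventuallyEq.rfl e1).trans ?_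
  rw [VectorField.mlieBracket_add_right, VectorField.mlieBracket_smul_right (hf _ _) hev.self_of_nhds,
    VectorField.mlieBracket_smul_right (hf _ _) hYU']
  · rfl
  · exact ((Y.app f).contMDiff.contMDiffAt.smul_section hU).mdifferentiableAt (by simp)
  · exact (f.contMDiff.contMDiffAt.smul_section hYU).mdifferentiableAt (by simp)

theorem smul_cancel_aux {W : Type*} [AddCommGroup W] [Module ℝ W] {a b c d e f : ℝ}
    {v p q r t : W} (h : a • v + b • p + (c • q + d • (r + t)) =
      e • v + d • r + (f • v + c • q + (b • p + d • t))) : (e - (a - f)) • v = 0 := by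
  have h' : (e - (a - f)) • v = (e • v + d • r + (f • v + c • q + (b • p + d • t))) -
    (a • v + b • p + (c • q + d • (r + t))) := by module
  rw [h', h, sub_self]

theorem dir_mlieBracket [CompleteSpace E] [IsManifold 𝓘(ℝ, E) ∞ M]
    (X Y : VField E M) (f : SmoothFn E M) (x : M) :
    mvfderiv 𝓘(ℝ, E) f x (VectorField.mlieBracket 𝓘(ℝ, E) X Y x) =
      X.app (Y.app f) x - Y.app (X.app f) x := by
  have := isManifold_three (E := E) (M := M)
  have hle : minSmoothness ℝ 2 ≤ ∞ := by
    simp only [minSmoothness_of_isRCLikeNormedField]; exact WithTop.coe_le_coe.2 le_top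
  rcases subsingleton_or_nontrivial E with hE | hE
  · have h0 : ∀ v : TangentSpace 𝓘(ℝ, E) x, v = 0 := fun v => Subsingleton.elim (α := E) v 0
    simp only [VField.app, ContMDiffMap.coeFn_mk]
    rw [h0 (VectorField.mlieBracket 𝓘(ℝ, E) X Y x), h0 (X x), h0 (Y x)]
    simp
  obtain ⟨v, hv⟩ := exists_ne (0 : E)
  set U : (y : M) → TangentSpace 𝓘(ℝ, E) y :=
    FiberBundle.extend E (E := (TangentSpace 𝓘(ℝ, E) : M → Type _)) (x := x) v with hUdef
  have hUx : U x = v := FiberBundle.extend_apply_self ..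
  have hU : ContMDiffAt 𝓘(ℝ, E) 𝓘(ℝ, E).tangent ∞
      (fun y => (⟨y, U y⟩ : TangentBundle 𝓘(ℝ, E) M)) x :=
    FiberBundle.contMDiffAt_extend 𝓘(ℝ, E) E (V := (TangentSpace 𝓘(ℝ, E) : M → Type _)) v
  have hfU := f.contMDiff.contMDiffAt.smul_section hU
  have hX : ContMDiffAt 𝓘(ℝ, E) 𝓘(ℝ, E).tangent ∞
      (fun y => (⟨y, X y⟩ : TangentBundle 𝓘(ℝ, E) M)) x := X.contMDiff.contMDiffAt
  have hY : ContMDiffAt 𝓘(ℝ, E) 𝓘(ℝ, E).tangent ∞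
      (fun y => (⟨y, Y y⟩ : TangentBundle 𝓘(ℝ, E) M)) x := Y.contMDiff.contMDiffAt
  have j1 := VectorField.leibniz_identity_mlieBracket_apply (hX.of_le hle) (hY.of_le hle)
    (hfU.of_le hle)
  have j2 := VectorField.leibniz_identity_mlieBracket_apply (hX.of_le hle) (hY.of_le hle)
    (hU.of_le hle)
  have := isManifold_two (E := E) (M := M)
  rw [bracket_bracket_smul X Y f hU, bracket_bracket_smul Y X f hU,
    VectorField.mlieBracket_smul_right (f.contMDiff.contMDiffAt.mdifferentiableAt (by simp))
      (hU.mdifferentiableAt (by simp)), j2, hUx] at j1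
  exact sub_eq_zero.1 ((smul_eq_zero.1 (smul_cancel_aux (W := E) j1)).resolve_right hv)

/-- The Lie bracket of smooth vector fields. -/
def VField.bracket [CompleteSpace E] [IsManifold 𝓘(ℝ, E) ∞ M] (X Y : VField E M) : VField E M :=
  ⟨VectorField.mlieBracket 𝓘(ℝ, E) X Y, fun _ =>
    contMDiffAt_bracket X.contMDiff.contMDiffAt Y.contMDiff.contMDiffAt⟩

theorem VField.bracket_app [CompleteSpace E] [IsManifold 𝓘(ℝ, E) ∞ M]
    (X Y : VField E M) (f : SmoothFn E M) :
    (X.bracket Y).app f = X.app (Y.app f) - Y.app (X.app f) :=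
  ContMDiffMap.ext fun x => dir_mlieBracket X Y f x

end Fields

section Alternating
variable {R V W : Type*} [CommRing R] [AddCommGroup V] [Module R V] [AddCommGroup W] [Module R W]

/-- The alternating `2`-form `(x, y) ↦ B x y` of an alternating bilinear map `B`. -/
def altTwo (B : V →ₗ[R] V →ₗ[R] W) (h : ∀ x, B x x = 0) : V [⋀^Fin 2]→ₗ[R] W where
  toFun v := B (v 0) (v 1)
  map_update_add' v i x y := by fin_cases i <;> simp
  map_update_smul' v i c x := by fin_cases i <;> simp
  map_eq_zero_of_eq' v i j hv hij := by
    have hB : ∀ a b, a = b → B a b = 0 := fun a b hab => hab ▸ h a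
    fin_cases i <;> fin_cases j <;> first | exact absurd rfl hij | skip
    · exact hB _ _ hv
    · exact hB _ _ hv.symm

@[simp] theorem altTwo_apply (B : V →ₗ[R] V →ₗ[R] W) (h : ∀ x, B x x = 0) (x y : V) :
    altTwo B h ![x, y] = B x y := rfl

/-- The alternating `3`-form `(x, y, z) ↦ T x y z`, for `T` linear in the last argument, odd under
the two transpositions of neighbours and zero when the first two arguments agree. -/
def altThree (T : V → V → V → W) (hadd : ∀ x y z z', T x y (z + z') = T x y z + T x y z')
    (hsmul : ∀ x y (c : R) z, T x y (c • z) = c • T x y z)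
    (h12 : ∀ x y z, T x y z = - T y x z) (h23 : ∀ x y z, T x y z = - T x z y)
    (h0 : ∀ x z, T x x z = 0) : V [⋀^Fin 3]→ₗ[R] W where
  toFun v := T (v 0) (v 1) (v 2)
  map_update_add' := by
    intro inst v i x y
    obtain rfl := Subsingleton.elim inst (instDecidableEqFin 3)
    obtain rfl | rfl | rfl : i = 0 ∨ i = 1 ∨ i = 2 := by lia
    · simp [h12 _ (v 1) (v 2), h23 (v 1) _ (v 2), hadd]
    · simp [h23 (v 0) _ (v 2), hadd, add_comm]
    · simp [hadd]
  map_update_smul' := by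
    intro inst v i c x
    obtain rfl := Subsingleton.elim inst (instDecidableEqFin 3)
    obtain rfl | rfl | rfl : i = 0 ∨ i = 1 ∨ i = 2 := by lia
    · simp [h12 _ (v 1) (v 2), h23 (v 1) _ (v 2), hsmul]
    · simp [h23 (v 0) _ (v 2), hsmul]
    · simp [hsmul]
  map_eq_zero_of_eq' v i j hv hij := by
    have k01 : ∀ a b c, a = b → T a b c = 0 := fun a b c hab => hab ▸ h0 a c
    have k02 : ∀ a b c, a = c → T a b c = 0 := fun a b c hab => by rw [h23, k01 _ _ _ hab, neg_zero]
    have k12 : ∀ a b c, b = c → T a b c = 0 := fun a b c hab => by rw [h12, k02 _ _ _ hab, neg_zero]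
    fin_cases i <;> fin_cases j <;> first
      | exact absurd rfl hij
      | exact k01 _ _ _ hv
      | exact k01 _ _ _ hv.symm
      | exact k02 _ _ _ hv
      | exact k02 _ _ _ hv.symm
      | exact k12 _ _ _ hv
      | exact k12 _ _ _ hv.symm

end Alternating

section Module
variable {E : Type*} [NormedAddCommGroup E] [NormedSpace ℝ E]
  {M : Type*} [TopologicalSpace M] [ChartedSpace E M]
  {F : Type*} [NormedAddCommGroup F] [NormedSpace ℝ F]
  {V : M → Type*} [TopologicalSpace (Bundle.TotalSpace F V)] [∀ x, TopologicalSpace (V x)]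
  [FiberBundle F V] [∀ x, AddCommGroup (V x)] [∀ x, Module ℝ (V x)] [VectorBundle ℝ F V]

/-- Smooth sections of a vector bundle form a module over `C^∞(M)`, with pointwise operations. -/
instance sectionModule : Module (SmoothFn E M) Cₛ^∞⟮𝓘(ℝ, E); F, V⟯ where
  smul f s := ⟨fun x => f x • s x, f.contMDiff.smul_section s.contMDiff⟩
  one_smul s := ContMDiffSection.ext fun x => one_smul ℝ (s x)
  mul_smul f g s := ContMDiffSection.ext fun x => mul_smul (f x) (g x) (s x)
  smul_zero f := ContMDiffSection.ext fun x => smul_zero (f x)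
  zero_smul s := ContMDiffSection.ext fun x => zero_smul ℝ (s x)
  smul_add f s t := ContMDiffSection.ext fun x => smul_add (f x) (s x) (t x)
  add_smul f g s := ContMDiffSection.ext fun x => add_smul (f x) (g x) (s x)

theorem smul_section_apply (f : SmoothFn E M) (s : Cₛ^∞⟮𝓘(ℝ, E); F, V⟯) (x : M) :
    (f • s) x = f x • s x := rfl

instance : SMulCommClass ℝ (SmoothFn E M) Cₛ^∞⟮𝓘(ℝ, E); F, V⟯ where
  smul_comm c f s := ContMDiffSection.ext fun x => smul_comm c (f x) (s x)

instance : SMulCommClass (SmoothFn E M) ℝ Cₛ^∞⟮𝓘(ℝ, E); F, V⟯ where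
  smul_comm f c s := ContMDiffSection.ext fun x => smul_comm (f x) c (s x)

end Module

section Atiyah
variable {E : Type*} [NormedAddCommGroup E] [NormedSpace ℝ E] [FiniteDimensional ℝ E]
  {M : Type*} [TopologicalSpace M] [ChartedSpace E M] [IsManifold 𝓘(ℝ, E) ∞ M]
  {L : M → Type*} [TopologicalSpace (Bundle.TotalSpace ℝ L)] [∀ x, TopologicalSpace (L x)]
  [FiberBundle ℝ L] [∀ x, AddCommGroup (L x)] [∀ x, Module ℝ (L x)] [VectorBundle ℝ ℝ L]

variable (E L) in
/-- `Γ(L)`, the smooth sections of the line bundle `L`. -/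
abbrev Sec : Type _ := Cₛ^∞⟮𝓘(ℝ, E); ℝ, L⟯

theorem VField.add_app (X Y : VField E M) (f : SmoothFn E M) :
    (X + Y).app f = X.app f + Y.app f :=
  ContMDiffMap.ext fun x => map_add (mvfderiv 𝓘(ℝ, E) f x) (X x) (Y x)

theorem VField.smul_app (g : SmoothFn E M) (X : VField E M) (f : SmoothFn E M) :
    (g • X).app f = g * X.app f :=
  ContMDiffMap.ext fun x => map_smul (mvfderiv 𝓘(ℝ, E) f x) (g x) (X x)

theorem VField.zero_app (f : SmoothFn E M) : (0 : VField E M).app f = 0 :=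
  ContMDiffMap.ext fun x => map_zero (mvfderiv 𝓘(ℝ, E) f x)

/-- `X` is the symbol of the operator `D`: `D (f λ) = X(f) λ + f D λ`. -/
def IsSymbol (X : VField E M) (D : Sec E L →ₗ[ℝ] Sec E L) : Prop :=
  ∀ (f : SmoothFn E M) (s : Sec E L), D (f • s) = X.app f • s + f • D s

theorem IsSymbol.comm {X Y : VField E M} {D D' : Sec E L →ₗ[ℝ] Sec E L}
    (h : IsSymbol X D) (h' : IsSymbol Y D') :
    haveI : CompleteSpace E := FiniteDimensional.complete ℝ E
    IsSymbol (X.bracket Y) (D ∘ₗ D' - D' ∘ₗ D) := by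
  have : CompleteSpace E := FiniteDimensional.complete ℝ E
  intro f s
  simp only [LinearMap.sub_apply, LinearMap.comp_apply, h f, h' f, map_add, h _, h' _,
    VField.bracket_app]
  module

variable (E L) in
/-- `Γ(DL)`: the derivations of `L`, i.e. the `ℝ`-linear operators on `Γ(L)` that have a symbol,
as a module over `C^∞(M)`. -/
def derivations : Submodule (SmoothFn E M) (Sec E L →ₗ[ℝ] Sec E L) where
  carrier := {D | ∃ X : VField E M, IsSymbol X D}
  add_mem' := by
    rintro D D' ⟨X, hX⟩ ⟨Y, hY⟩
    refine ⟨X + Y, fun f s => ?_⟩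
    simp only [LinearMap.add_apply, hX f, hY f, VField.add_app]
    module
  zero_mem' := ⟨0, fun f s => by simp [VField.zero_app]⟩
  smul_mem' := by
    rintro g D ⟨X, hX⟩
    refine ⟨g • X, fun f s => ?_⟩
    simp only [LinearMap.smul_apply, hX f, VField.smul_app]
    module

variable (E L) in
/-- `Γ(DL)`, the sections of the Atiyah algebroid of `L`. -/
abbrev Der : Type _ := derivations E L

/-- The Lie bracket of `Γ(DL)` is the commutator of operators. -/
instance : Bracket (Der E L) (Der E L) where
  bracket D D' := ⟨D.1 ∘ₗ D'.1 - D'.1 ∘ₗ D.1, by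
    obtain ⟨X, hX⟩ := D.2
    obtain ⟨Y, hY⟩ := D'.2
    exact ⟨_, hX.comm hY⟩⟩

theorem lie_val (D D' : Der E L) (s : Sec E L) :
    ⁅D, D'⁆.1 s = D.1 (D'.1 s) - D'.1 (D.1 s) := rfl

theorem lie_add_right (D A B : Der E L) : ⁅D, A + B⁆ = ⁅D, A⁆ + ⁅D, B⁆ := by
  apply Subtype.ext; apply LinearMap.ext; intro s
  simp only [lie_val, Submodule.coe_add, LinearMap.add_apply, map_add]
  abel

theorem lie_symm (D A : Der E L) : ⁅D, A⁆ = -⁅A, D⁆ := by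
  apply Subtype.ext; apply LinearMap.ext; intro s
  simp only [lie_val, Submodule.coe_neg, LinearMap.neg_apply]
  abel

theorem lie_self_eq (D : Der E L) : ⁅D, D⁆ = 0 := by
  apply Subtype.ext; apply LinearMap.ext; intro s
  simp [lie_val]

theorem lie_smul_right {X : VField E M} {D : Der E L} (h : IsSymbol X D.1) (f : SmoothFn E M)
    (A : Der E L) : ⁅D, f • A⁆ = X.app f • A + f • ⁅D, A⁆ := by
  apply Subtype.ext; apply LinearMap.ext; intro s
  simp only [lie_val, Submodule.coe_add, Submodule.coe_smul, LinearMap.add_apply,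
    LinearMap.smul_apply, h f]
  module

variable (E L) in
/-- `Γ(J¹L)`, where `J¹L = (DL)^* ⊗ L`: the `C^∞(M)`-linear maps `Γ(DL) → Γ(L)`. Evaluation is the
`L`-valued duality pairing `⟨Δ, ψ⟩_L`. -/
abbrev Jet : Type _ := Der E L →ₗ[SmoothFn E M] Sec E L

variable (E L) in
/-- `L`-valued Atiyah `k`-forms, the sections of `⋀^k (DL)^* ⊗ L`. -/
abbrev AtiyahForm (k : ℕ) : Type _ := Der E L [⋀^Fin k]→ₗ[SmoothFn E M] Sec E L

/-- `d_{DL}` on `0`-forms: `(dλ)(Δ) = Δ λ`. -/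
def dZero (s : Sec E L) : Jet E L where
  toFun D := D.1 s
  map_add' _ _ := rfl
  map_smul' _ _ := rfl

/-- The Lie derivative on `Γ(J¹L)`: `(ℒ_Δ ψ)(∇) = Δ (ψ ∇) - ψ [Δ, ∇]`. -/
def lieDer (D : Der E L) (ψ : Jet E L) : Jet E L where
  toFun A := D.1 (ψ A) - ψ ⁅D, A⁆
  map_add' A B := by rw [lie_add_right, map_add, map_add, map_add]; abel
  map_smul' f A := by
    obtain ⟨X, hX⟩ := D.2
    simp only [lie_smul_right hX, map_add, map_smul, hX f, RingHom.id_apply]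
    module

/-- `d_{DL}` on `1`-forms: `(dφ)(Δ, ∇) = Δ (φ ∇) - ∇ (φ Δ) - φ [Δ, ∇]`. -/
def dOne (φ : Jet E L) : AtiyahForm E L 2 :=
  altTwo
    (LinearMap.mk₂ (SmoothFn E M) (fun A B => A.1 (φ B) - B.1 (φ A) - φ ⁅A, B⁆)
      (fun A A' B => by
        rw [lie_symm, lie_symm A, lie_symm A', lie_add_right]
        simp only [map_add, map_neg, Submodule.coe_add, LinearMap.add_apply]; abel)
      (fun f A B => by
        obtain ⟨X, hX⟩ := B.2
        rw [lie_symm, lie_symm A, lie_smul_right hX]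
        simp only [map_add, map_neg, map_smul, Submodule.coe_smul, LinearMap.smul_apply, hX f]
        module)
      (fun A B B' => by
        rw [lie_add_right]
        simp only [map_add, Submodule.coe_add, LinearMap.add_apply]; abel)
      (fun f A B => by
        obtain ⟨X, hX⟩ := A.2
        rw [lie_smul_right hX]
        simp only [map_add, map_smul, Submodule.coe_smul, LinearMap.smul_apply, hX f]
        module))
    (fun A => by simp [lie_self_eq])

theorem form_swap (w : AtiyahForm E L 2) (A B : Der E L) : w ![A, B] = - w ![B, A] := by
  have := w.map_swap ![B, A] (i := 0) (j := 1) (by decide)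
  rw [← this]
  congr 1
  funext i; fin_cases i <;> rfl

theorem update_pair (A B C : Der E L) : Function.update ![A, C] 1 B = ![A, B] := by
  funext i; fin_cases i <;> rfl

theorem form_add (w : AtiyahForm E L 2) (A B B' : Der E L) :
    w ![A, B + B'] = w ![A, B] + w ![A, B'] := by
  simpa only [update_pair] using w.map_update_add ![A, 0] 1 B B'

theorem form_smul (w : AtiyahForm E L 2) (f : SmoothFn E M) (A B : Der E L) :
    w ![A, f • B] = f • w ![A, B] := by
  simpa only [update_pair] using w.map_update_smul ![A, 0] 1 f B

theorem form_add_left (w : AtiyahForm E L 2) (A B B' : Der E L) :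
    w ![B + B', A] = w ![B, A] + w ![B', A] := by
  rw [form_swap, form_add, form_swap w B, form_swap w B', neg_add]

theorem form_smul_left (w : AtiyahForm E L 2) (f : SmoothFn E M) (A B : Der E L) :
    w ![f • B, A] = f • w ![B, A] := by
  rw [form_swap, form_smul, form_swap w B, smul_neg]

theorem form_self (w : AtiyahForm E L 2) (A : Der E L) : w ![A, A] = 0 :=
  w.map_eq_zero_of_eq ![A, A] (i := 0) (j := 1) rfl (by decide)

theorem form_neg_left (w : AtiyahForm E L 2) (A B : Der E L) : w ![-B, A] = - w ![B, A] := by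
  rw [← neg_one_smul (SmoothFn E M) B, form_smul_left, neg_one_smul]

theorem form_zero_left (w : AtiyahForm E L 2) (A : Der E L) : w ![0, A] = 0 := by
  rw [← zero_smul (SmoothFn E M) (0 : Der E L), form_smul_left, zero_smul]

/-- `d_{DL}` on `2`-forms:
`(dω)(Δ, ∇, □) = Δ ω(∇, □) - ∇ ω(Δ, □) + □ ω(Δ, ∇) - ω([Δ, ∇], □) + ω([Δ, □], ∇) - ω([∇, □], Δ)`. -/
def dTwo (w : AtiyahForm E L 2) : AtiyahForm E L 3 :=
  altThree
    (fun A B C => A.1 (w ![B, C]) - B.1 (w ![A, C]) + C.1 (w ![A, B])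
      - w ![⁅A, B⁆, C] + w ![⁅A, C⁆, B] - w ![⁅B, C⁆, A])
    (fun A B C C' => by
      simp only [lie_add_right, form_add, form_add_left, map_add, Submodule.coe_add,
        LinearMap.add_apply]
      abel)
    (fun A B f C => by
      obtain ⟨X, hX⟩ := A.2
      obtain ⟨Y, hY⟩ := B.2
      simp only [lie_smul_right hX, lie_smul_right hY, form_add_left, form_smul, form_smul_left,
        Submodule.coe_smul, LinearMap.smul_apply, hX f, hY f]
      rw [form_swap w C B, form_swap w C A]
      module)
    (fun A B C => by
      rw [lie_symm A B, form_neg_left, form_swap w A B, map_neg]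
      abel)
    (fun A B C => by
      rw [lie_symm B C, form_neg_left, form_swap w B C, map_neg]
      abel)
    (fun A C => by
      rw [lie_self_eq, form_self, map_zero, form_zero_left]
      abel)

theorem dTwo_apply (w : AtiyahForm E L 2) (A B C : Der E L) :
    dTwo w ![A, B, C] = A.1 (w ![B, C]) - B.1 (w ![A, C]) + C.1 (w ![A, B])
      - w ![⁅A, B⁆, C] + w ![⁅A, C⁆, B] - w ![⁅B, C⁆, A] := rfl

theorem dOne_apply (φ : Jet E L) (A B : Der E L) :
    dOne φ ![A, B] = A.1 (φ B) - B.1 (φ A) - φ ⁅A, B⁆ := rfl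

/-- `i_Δ ω = ω(Δ, -)` for a `2`-form `ω`, as a section of `J¹L`. -/
def contractTwo (w : AtiyahForm E L 2) (A : Der E L) : Jet E L where
  toFun B := w ![A, B]
  map_add' := form_add w A
  map_smul' f := form_smul w f A

/-- `Ω(Δ, ∇, -)` for a `3`-form `Ω`, as a section of `J¹L`. -/
def contractThree (Ω : AtiyahForm E L 3) (A B : Der E L) : Jet E L where
  toFun C := Ω ![A, B, C]
  map_add' C C' := by
    have h : ∀ C, Function.update ![A, B, 0] 2 C = ![A, B, C] := fun C => by
      funext i; fin_cases i <;> rfl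
    simpa only [h] using Ω.map_update_add ![A, B, 0] 2 C C'
  map_smul' f C := by
    have h : ∀ C, Function.update ![A, B, 0] 2 C = ![A, B, C] := fun C => by
      funext i; fin_cases i <;> rfl
    simpa only [h] using! Ω.map_update_smul ![A, B, 0] 2 f C

variable (E L) in
/-- `Γ(𝔻L)`, the sections of the omni-Lie algebroid `𝔻L = DL ⊕ J¹L`. -/
abbrev Omni : Type _ := Der E L × Jet E L

/-- The symmetric `L`-valued pairing `⟨⟨(Δ, φ), (∇, ψ)⟩⟩ = ⟨Δ, ψ⟩_L + ⟨∇, φ⟩_L`. -/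
def pairing (α β : Omni E L) : Sec E L := β.2 α.1 + α.2 β.1

/-- The Dorfman–Jacobi bracket `[[(Δ, φ), (∇, ψ)]] = ([Δ, ∇], ℒ_Δ ψ - i_∇ dφ)`. -/
def dorfman (α β : Omni E L) : Omni E L :=
  (⁅α.1, β.1⁆, lieDer α.1 β.2 - contractTwo (dOne α.2) β.1)

/-- The adjoint `φ† : J¹L → J¹L` of an endomorphism `φ` of `DL`: `⟨Δ, φ† ψ⟩_L = ⟨φ Δ, ψ⟩_L`. -/
def adj (φ : Der E L →ₗ[SmoothFn E M] Der E L) : Jet E L →ₗ[SmoothFn E M] Jet E L where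
  toFun ψ := ψ ∘ₗ φ
  map_add' _ _ := rfl
  map_smul' _ _ := rfl

/-- The torsion of an endomorphism `φ` of `DL`:
`N_φ(Δ, ∇) = [φΔ, φ∇] + φ²[Δ, ∇] - φ[φΔ, ∇] - φ[Δ, φ∇]`. -/
def torsionDer (φ : Der E L →ₗ[SmoothFn E M] Der E L) (A B : Der E L) : Der E L :=
  ⁅φ A, φ B⁆ + φ (φ ⁅A, B⁆) - φ ⁅φ A, B⁆ - φ ⁅A, φ B⁆

variable (E L) in
/-- A generalized almost contact structure on `L`: a vector bundle endomorphism `𝓘` of `𝔻L`, given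
by its `C^∞(M)`-linear action on sections, with `𝓘² = -id` and `𝓘† = -𝓘` (the adjoint being taken
with respect to the pairing of `𝔻L`). -/
structure GenAlmostContact where
  /-- The endomorphism. -/
  toLin : Omni E L →ₗ[SmoothFn E M] Omni E L
  sq : ∀ α, toLin (toLin α) = -α
  skew : ∀ α β, pairing (toLin α) β = - pairing α (toLin β)

namespace GenAlmostContact
variable (I : GenAlmostContact E L)

/-- The Nijenhuis torsion
`N_𝓘(α, β) = [[𝓘α, 𝓘β]] - [[α, β]] - 𝓘[[𝓘α, β]] - 𝓘[[α, 𝓘β]]`. -/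
def torsion (α β : Omni E L) : Omni E L :=
  dorfman (I.toLin α) (I.toLin β) - dorfman α β - I.toLin (dorfman (I.toLin α) β)
    - I.toLin (dorfman α (I.toLin β))

/-- `𝓘` is integrable if its Nijenhuis torsion vanishes identically. -/
def IsIntegrable : Prop := ∀ α β : Omni E L, I.torsion α β = 0

/-- The component `φ : DL → DL` of `𝓘`. -/
def phi : Der E L →ₗ[SmoothFn E M] Der E L :=
  LinearMap.fst _ _ _ ∘ₗ I.toLin ∘ₗ LinearMap.inl _ _ _

/-- The component `J^♯ : J¹L → DL` of `𝓘`. -/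
def Jsharp : Jet E L →ₗ[SmoothFn E M] Der E L :=
  LinearMap.fst _ _ _ ∘ₗ I.toLin ∘ₗ LinearMap.inr _ _ _

/-- The component `ω^♭ : DL → J¹L` of `𝓘`. -/
def omegaFlat : Der E L →ₗ[SmoothFn E M] Jet E L :=
  LinearMap.snd _ _ _ ∘ₗ I.toLin ∘ₗ LinearMap.inl _ _ _

theorem eq_zero_of_eq_neg {s : Sec E L} (h : s = -s) : s = 0 := by
  have h2 : (2 : ℝ) • s = 0 := by
    rw [two_smul]; nth_rewrite 2 [h]; abel
  exact (smul_eq_zero.1 h2).resolve_left two_ne_zero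

theorem Jsharp_skew (φ ψ : Jet E L) : ψ (I.Jsharp φ) = - φ (I.Jsharp ψ) := by
  have := I.skew (0, φ) (0, ψ)
  simpa [pairing, Jsharp] using this

theorem omegaFlat_skew (A B : Der E L) : I.omegaFlat A B = - I.omegaFlat B A := by
  have := I.skew (A, 0) (B, 0)
  simpa [pairing, omegaFlat] using this

/-- The block form of `𝓘`; in particular its lower right entry is `-φ†`. -/
theorem toLin_apply (A : Der E L) (ψ : Jet E L) :
    I.toLin (A, ψ) = (I.phi A + I.Jsharp ψ, I.omegaFlat A - adj I.phi ψ) := by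
  have hsplit : ((A, ψ) : Omni E L) = (A, 0) + (0, ψ) := by simp
  rw [hsplit, map_add]
  refine Prod.ext rfl ?_
  have h : (I.toLin (0, ψ)).2 = - adj I.phi ψ := by
    apply LinearMap.ext
    intro B
    have := I.skew (0, ψ) (B, 0)
    simpa [pairing, phi, adj] using this
  change (I.toLin (A, 0)).2 + (I.toLin (0, ψ)).2 = _
  rw [h, sub_eq_add_neg]
  rfl

theorem omegaFlat_phi (A B : Der E L) : I.omegaFlat (I.phi A) B = I.omegaFlat A (I.phi B) := by
  have h := I.sq (A, 0)
  rw [toLin_apply, toLin_apply] at h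
  have h2 := congrArg (fun p : Omni E L => p.2 B) h
  simp only [map_zero, add_zero, sub_zero, Prod.snd_neg, neg_zero, LinearMap.sub_apply,
    LinearMap.zero_apply] at h2
  exact sub_eq_zero.1 h2

/-- The `2`-form `J : ⋀² J¹L → L`, with `J(φ, ψ) = ⟨J^♯ φ, ψ⟩_L`. -/
def J : Jet E L [⋀^Fin 2]→ₗ[SmoothFn E M] Sec E L :=
  altTwo
    (LinearMap.mk₂ (SmoothFn E M) (fun φ ψ => ψ (I.Jsharp φ))
      (fun _ _ _ => by simp) (fun _ _ _ => by simp) (fun _ _ _ => rfl) (fun _ _ _ => rfl))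
    (fun φ => eq_zero_of_eq_neg (I.Jsharp_skew φ φ))

/-- The Atiyah `2`-form `ω : ⋀² DL → L`, with `ω(Δ, ∇) = ⟨∇, ω^♭ Δ⟩_L`. -/
def omega : AtiyahForm E L 2 :=
  altTwo I.omegaFlat (fun A => eq_zero_of_eq_neg (I.omegaFlat_skew A A))

/-- The Atiyah `2`-form `ω_φ(Δ, ∇) = ω(φΔ, ∇)`. -/
def omegaPhi : AtiyahForm E L 2 :=
  altTwo (I.omegaFlat ∘ₗ I.phi) (fun A => eq_zero_of_eq_neg (by
    rw [LinearMap.comp_apply]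
    nth_rewrite 1 [I.omegaFlat_phi]
    exact I.omegaFlat_skew _ _))

/-- The bracket `[φ, ψ]_J = ℒ_{J^♯ φ} ψ - ℒ_{J^♯ ψ} φ - d J(φ, ψ)` on `Γ(J¹L)`. -/
def bracketJ (φ ψ : Jet E L) : Jet E L :=
  lieDer (I.Jsharp φ) ψ - lieDer (I.Jsharp ψ) φ - dZero (I.J ![φ, ψ])

end GenAlmostContact
end Atiyah
end GeneralizedContact

end

namespace GeneralizedContact

/-! ### Calculus of the Dorfman–Jacobi bracket and its pairing. -/

section Omni
variable {E : Type*} [NormedAddCommGroup E] [NormedSpace ℝ E] [FiniteDimensional ℝ E]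
  {M : Type*} [TopologicalSpace M] [ChartedSpace E M] [IsManifold 𝓘(ℝ, E) ∞ M]
  {L : M → Type*} [TopologicalSpace (Bundle.TotalSpace ℝ L)] [∀ x, TopologicalSpace (L x)]
  [FiberBundle ℝ L] [∀ x, AddCommGroup (L x)] [∀ x, Module ℝ (L x)] [VectorBundle ℝ ℝ L]

/-! The expression ⟨⟨N(α, β), γ⟩⟩, with N the Nijenhuis torsion of 𝓘, is alternating in its three
arguments. Skewness in α, β (`torsion_swap`) comes from the symmetric part of the bracket being
exact, with potential ⟨⟨α, β⟩⟩, while 𝓘 is both skew and orthogonal. Skewness in β, γ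
(`pairing_torsion`) comes from the invariance of the pairing under the bracket.

Since 𝔻L = DL ⊕ J¹L, a mixed value N(Δ, ψ) paired with a derivation or a jet is then, up to sign, a
value of N on two derivations or on two jets paired with the remaining argument. The pairing is
nondegenerate, as the jets dλ already detect every derivation, so integrability means that N
vanishes on DL × DL and on J¹L × J¹L (`isIntegrable_iff`).

Each of these two restrictions has two components. On pairs of jets they are the defects of (C1) and
(C2) (`torsion_jet`); on pairs of derivations they are those of (C3) and (C4) (`torsion_der`,
`torsion_der_snd_apply`). -/

theorem lieDer_apply (D : Der E L) (ψ : Jet E L) (A : Der E L) :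
    lieDer D ψ A = D.1 (ψ A) - ψ ⁅D, A⁆ := rfl

theorem dZero_apply (s : Sec E L) (D : Der E L) : dZero s D = D.1 s := rfl

theorem contractTwo_apply (w : AtiyahForm E L 2) (A B : Der E L) :
    contractTwo w A B = w ![A, B] := rfl

theorem contractThree_apply (w : AtiyahForm E L 3) (A B C : Der E L) :
    contractThree w A B C = w ![A, B, C] := rfl

theorem adj_apply (f : Der E L →ₗ[SmoothFn E M] Der E L) (ψ : Jet E L) (A : Der E L) :
    adj f ψ A = ψ (f A) := rfl

theorem lie_add_left (A B D : Der E L) : ⁅A + B, D⁆ = ⁅A, D⁆ + ⁅B, D⁆ := by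
  rw [lie_symm, lie_add_right, lie_symm A, lie_symm B, neg_add]

theorem lie_zero_left (D : Der E L) : ⁅(0 : Der E L), D⁆ = 0 := by
  simpa using lie_add_left (0 : Der E L) 0 D

theorem lie_zero_right (D : Der E L) : ⁅D, (0 : Der E L)⁆ = 0 := by
  rw [lie_symm, lie_zero_left, neg_zero]

/-- Cartan's formula `i_Δ d φ = ℒ_Δ φ - d ⟨Δ, φ⟩` on `Γ(J¹L)`. -/
theorem contractTwo_dOne (φ : Jet E L) (A : Der E L) :
    contractTwo (dOne φ) A = lieDer A φ - dZero (φ A) := by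
  ext1 B
  simp only [contractTwo_apply, dOne_apply, LinearMap.sub_apply, lieDer_apply, dZero_apply]
  abel

/-- The jets `dλ` separate derivations. -/
theorem der_eq_zero {A : Der E L} (h : ∀ ψ : Jet E L, ψ A = 0) : A = 0 :=
  Subtype.ext (LinearMap.ext fun s => h (dZero s))

theorem dorfman_snd_apply (α β : Omni E L) (C : Der E L) :
    (dorfman α β).2 C = α.1.1 (β.2 C) - β.2 ⁅α.1, C⁆
      - (β.1.1 (α.2 C) - C.1 (α.2 β.1) - α.2 ⁅β.1, C⁆) := rfl

theorem dorfman_add_left (α α' β : Omni E L) :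
    dorfman (α + α') β = dorfman α β + dorfman α' β := by
  refine Prod.ext (lie_add_left _ _ _) (LinearMap.ext fun C => ?_)
  simp only [Prod.snd_add, LinearMap.add_apply, dorfman_snd_apply, Prod.fst_add, lie_add_left,
    map_add, Submodule.coe_add]
  abel

theorem dorfman_add_right (α β β' : Omni E L) :
    dorfman α (β + β') = dorfman α β + dorfman α β' := by
  refine Prod.ext (lie_add_right _ _ _) (LinearMap.ext fun C => ?_)
  simp only [Prod.snd_add, LinearMap.add_apply, dorfman_snd_apply, Prod.fst_add, lie_add_left,
    map_add, Submodule.coe_add]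
  abel

/-- The symmetric part of the Dorfman–Jacobi bracket is `d ⟨⟨-, -⟩⟩`. -/
theorem dorfman_add_swap (α β : Omni E L) :
    dorfman α β + dorfman β α = (0, dZero (pairing α β)) := by
  refine Prod.ext ?_ (LinearMap.ext fun C => ?_)
  · change ⁅α.1, β.1⁆ + ⁅β.1, α.1⁆ = 0
    rw [lie_symm, neg_add_cancel]
  · simp only [Prod.snd_add, LinearMap.add_apply, dorfman_snd_apply, dZero_apply, pairing, map_add]
    abel

/-- The pairing is invariant under the Dorfman–Jacobi bracket. -/
theorem pairing_dorfman (α β γ : Omni E L) :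
    pairing (dorfman α β) γ + pairing β (dorfman α γ) = α.1.1 (pairing β γ) := by
  have h : ∀ δ : Omni E L, (dorfman α δ).1 = ⁅α.1, δ.1⁆ := fun _ => rfl
  simp only [pairing, dorfman_snd_apply, h, map_add]
  -- Each of the two pairings contributes the jet of α on a bracket of β and γ, in opposite orders;
  -- these two terms cancel.
  rw [lie_symm γ.1 β.1, map_neg]
  abel

theorem pairing_add_left (α α' β : Omni E L) :
    pairing (α + α') β = pairing α β + pairing α' β := by
  simp only [pairing, Prod.fst_add, Prod.snd_add, map_add, LinearMap.add_apply]
  abel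

theorem pairing_comm (α β : Omni E L) : pairing α β = pairing β α :=
  add_comm _ _

theorem pairing_neg_left (α β : Omni E L) : pairing (-α) β = -pairing α β := by
  simp only [pairing, Prod.fst_neg, Prod.snd_neg, map_neg, LinearMap.neg_apply, neg_add]

theorem pairing_sub_left (α α' β : Omni E L) :
    pairing (α - α') β = pairing α β - pairing α' β := by
  rw [sub_eq_add_neg, pairing_add_left, pairing_neg_left, sub_eq_add_neg]

theorem pairing_sub_right (α β β' : Omni E L) :
    pairing α (β - β') = pairing α β - pairing α β' := by
  rw [pairing_comm, pairing_sub_left, pairing_comm β, pairing_comm β']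

/-- The pairing is nondegenerate. -/
theorem eq_zero_of_pairing {α : Omni E L} (h₁ : ∀ A : Der E L, pairing α (A, 0) = 0)
    (h₂ : ∀ ψ : Jet E L, pairing α (0, ψ) = 0) : α = 0 := by
  refine Prod.ext (der_eq_zero fun ψ => ?_) (LinearMap.ext fun A => ?_)
  · simpa [pairing] using h₂ ψ
  · simpa [pairing] using h₁ A

/-! ### Symmetries of the Nijenhuis torsion. -/

namespace GenAlmostContact
variable (I : GenAlmostContact E L)

theorem J_apply (φ ψ : Jet E L) : I.J ![φ, ψ] = ψ (I.Jsharp φ) := rfl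

theorem omega_apply (A B : Der E L) : I.omega ![A, B] = I.omegaFlat A B := rfl

theorem omegaPhi_apply (A B : Der E L) : I.omegaPhi ![A, B] = I.omegaFlat (I.phi A) B := rfl

/-- Being skew with square -id makes 𝓘 orthogonal. -/
theorem pairing_toLin_toLin (α β : Omni E L) :
    pairing (I.toLin α) (I.toLin β) = pairing α β := by
  rw [I.skew, I.sq, pairing_comm α, pairing_neg_left, neg_neg, pairing_comm]

/-- Additivity is all that is used later: a section of 𝔻L is the sum of its two components, so
tensoriality over C^∞(M) is not needed. -/
theorem torsion_add_left (α α' β : Omni E L) :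
    I.torsion (α + α') β = I.torsion α β + I.torsion α' β := by
  simp only [torsion, map_add, dorfman_add_left]
  abel

theorem torsion_add_right (α β β' : Omni E L) :
    I.torsion α (β + β') = I.torsion α β + I.torsion α β' := by
  simp only [torsion, map_add, dorfman_add_right]
  abel

/-- Symmetrizing turns every bracket into d of a pairing. Orthogonality of 𝓘 cancels the first two
terms, and skewness cancels the two to which 𝓘 is applied. -/
theorem torsion_swap (α β : Omni E L) : I.torsion α β = -I.torsion β α := by
  rw [eq_neg_iff_add_eq_zero]
  have h : I.torsion α β + I.torsion β α =
      (dorfman (I.toLin α) (I.toLin β) + dorfman (I.toLin β) (I.toLin α))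
        - (dorfman α β + dorfman β α)
        - I.toLin ((dorfman (I.toLin α) β + dorfman β (I.toLin α))
          + (dorfman α (I.toLin β) + dorfman (I.toLin β) α)) := by
    simp only [torsion, map_add]
    abel
  rw [h, dorfman_add_swap, dorfman_add_swap, dorfman_add_swap, dorfman_add_swap,
    pairing_toLin_toLin, I.skew, sub_self, zero_sub, Prod.mk_add_mk]
  have h0 : dZero (-pairing α (I.toLin β)) + dZero (pairing α (I.toLin β)) = 0 := by
    ext1 C
    simp [dZero_apply]
  rw [h0, add_zero, ← Prod.zero_eq_mk, map_zero, neg_zero]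

/-- Invariance of the pairing is applied along 𝓘α and along α, twice each. The derivative terms
cancel: ⟨⟨𝓘β, γ⟩⟩ = -⟨⟨β, 𝓘γ⟩⟩ along 𝓘α, and ⟨⟨𝓘β, 𝓘γ⟩⟩ = ⟨⟨β, γ⟩⟩ along α. -/
theorem pairing_torsion (α β γ : Omni E L) :
    pairing (I.torsion α β) γ = -pairing (I.torsion α γ) β := by
  have h₁ := pairing_dorfman (I.toLin α) (I.toLin β) γ
  have h₂ := pairing_dorfman (I.toLin α) β (I.toLin γ)
  have h₃ := pairing_dorfman α β γ
  have h₄ := pairing_dorfman α (I.toLin β) (I.toLin γ)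
  rw [I.skew β γ, map_neg, ← h₂] at h₁
  rw [I.pairing_toLin_toLin, ← h₃] at h₄
  have h : ∀ δ ε, pairing δ (I.toLin ε) = -pairing (I.toLin δ) ε := fun δ ε => by
    rw [I.skew, neg_neg]
  rw [eq_neg_iff_add_eq_zero, pairing_comm _ β]
  simp only [torsion, pairing_sub_left, pairing_sub_right, I.skew (dorfman _ _), h β]
  rw [← sub_eq_zero] at h₁ h₄
  -- The right side becomes 0 + 0, and each zero is replaced by one of the vanishing combinations
  -- `h₁`, `h₄`; their sum is the left side.
  rw [← add_zero (0 : Sec E L)]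
  nth_rewrite 1 [← h₁]
  rw [← h₄]
  abel

/-! ### The torsion on each of the two summands. -/

/-- The torsion on sections of `DL`. -/
theorem torsion_der (A B : Der E L) :
    I.torsion (A, 0) (B, 0) =
      (torsionDer I.phi A B - I.Jsharp (contractThree (dTwo I.omega) A B),
        lieDer (I.phi A) (I.omegaFlat B) - contractTwo (dOne (I.omegaFlat A)) (I.phi B)
          - I.omegaFlat ⁅I.phi A, B⁆ - adj I.phi (contractTwo (dOne (I.omegaFlat A)) B)
          - I.omegaFlat ⁅A, I.phi B⁆ + adj I.phi (lieDer A (I.omegaFlat B))) := by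
  -- The DL-component of 𝓘² = -id trades the term -[A, B] of the torsion for φ²[A, B] + J^♯ω^♭[A,
  -- B]: the first belongs to the torsion of φ, the second to dω by `hd`.
  have hsq := congrArg Prod.fst (I.sq (⁅A, B⁆, 0))
  simp only [toLin_apply, map_zero, add_zero, sub_zero, Prod.fst_neg] at hsq
  have hd : contractThree (dTwo I.omega) A B =
      lieDer A (I.omegaFlat B) - contractTwo (dOne (I.omegaFlat A)) B - I.omegaFlat ⁅A, B⁆ := by
    ext1 C
    simp only [contractThree_apply, dTwo_apply, omega_apply, LinearMap.sub_apply, lieDer_apply,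
      contractTwo_apply, dOne_apply]
    rw [I.omegaFlat_skew ⁅A, C⁆, I.omegaFlat_skew ⁅B, C⁆]
    abel
  have h0 : ∀ D : Der E L, lieDer D 0 = 0 := fun D => by
    ext1 C; simp [lieDer_apply]
  have h1 : ∀ D : Der E L, contractTwo (dOne 0) D = 0 := fun D => by
    ext1 C; simp [contractTwo_apply, dOne_apply]
  refine Prod.ext ?_ ?_
  · simp only [torsion, dorfman, toLin_apply, map_zero, add_zero, sub_zero, Prod.fst_sub, h0, h1,
      zero_sub, map_neg, hd, map_sub, torsionDer, eq_sub_of_add_eq hsq]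
    abel
  · simp only [torsion, dorfman, toLin_apply, map_zero, add_zero, sub_zero, Prod.snd_sub, h0, h1,
      zero_sub, map_neg]
    abel

/-- Because 𝓘² = -id forces ω(φΔ, ∇) = ω(Δ, φ∇), every φ inside ω can be moved to the second slot;
both sides then expand into the same terms. -/
theorem torsion_der_snd_apply (A B C : Der E L) :
    (I.torsion (A, 0) (B, 0)).2 C =
      dTwo I.omega ![I.phi A, B, C] + dTwo I.omega ![A, I.phi B, C]
        + dTwo I.omega ![A, B, I.phi C] - dTwo I.omegaPhi ![A, B, C] := by
  rw [torsion_der]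
  simp only [LinearMap.add_apply, LinearMap.sub_apply, adj_apply, lieDer_apply, contractTwo_apply,
    dOne_apply, dTwo_apply, omega_apply, omegaPhi_apply, I.omegaFlat_phi]
  rw [I.omegaFlat_skew ⁅I.phi A, C⁆, I.omegaFlat_skew ⁅I.phi B, C⁆, I.omegaFlat_skew ⁅A, I.phi C⁆,
    I.omegaFlat_skew ⁅B, I.phi C⁆]
  abel

/-- The torsion on sections of `J¹L`. -/
theorem torsion_jet (φ ψ : Jet E L) :
    I.torsion (0, φ) (0, ψ) =
      (⁅I.Jsharp φ, I.Jsharp ψ⁆ - I.Jsharp (I.bracketJ φ ψ),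
        adj I.phi (I.bracketJ φ ψ) - (lieDer (I.Jsharp φ) (adj I.phi ψ)
          - lieDer (I.Jsharp ψ) (adj I.phi φ) - dZero (I.J ![adj I.phi φ, ψ]))) := by
  have h0 : dorfman (0, φ) ((0, ψ) : Omni E L) = 0 := by
    refine Prod.ext (lie_self_eq _) (LinearMap.ext fun C => ?_)
    simp [dorfman_snd_apply, lie_zero_left]
  have hl : ∀ χ : Jet E L, lieDer 0 χ = 0 := fun χ => by
    ext1 C; simp [lieDer_apply, lie_zero_left]
  have hc : ∀ χ : Jet E L, contractTwo (dOne χ) 0 = 0 := fun χ => by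
    rw [contractTwo_dOne, hl]; ext1 C; simp [dZero_apply]
  have hn : ∀ s : Sec E L, dZero (-s) = -dZero s := fun s => by
    ext1 C; simp [dZero_apply]
  have hdn : ∀ (D : Der E L) (χ : Jet E L), lieDer D (-χ) = -lieDer D χ := fun D χ => by
    ext1 C; simp [lieDer_apply]; abel
  rw [torsion, h0]
  simp only [dorfman, toLin_apply, map_zero, zero_add, zero_sub, sub_zero, lie_zero_left,
    lie_zero_right, hl, hc, bracketJ, J_apply, contractTwo_dOne, hdn, adj_apply, LinearMap.neg_apply,
    hn]
  -- Cartan's formula leaves exact terms in which φ and φ†φ are evaluated on J^♯ψ; skewness of J^♯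
  -- identifies them with -J(φ, ψ) and -J(φ†φ, ψ).
  rw [I.Jsharp_skew φ ψ, hn, ← adj_apply, I.Jsharp_skew (adj I.phi φ) ψ, hn]
  refine Prod.ext ?_ ?_
  · simp only [Prod.fst_sub, map_sub, map_neg]
    abel
  · simp only [Prod.snd_sub, map_sub, map_neg, adj_apply]
    abel

/-- The mixed torsion comes for free: it is tested against each summand, and the alternating
symmetry turns each test into one on an unmixed value. -/
theorem isIntegrable_iff : I.IsIntegrable ↔
    (∀ φ ψ : Jet E L, I.torsion (0, φ) (0, ψ) = 0) ∧
      ∀ A B : Der E L, I.torsion (A, 0) (B, 0) = 0 := by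
  refine ⟨fun h => ⟨fun _ _ => h _ _, fun _ _ => h _ _⟩, fun ⟨hJ, hD⟩ => ?_⟩
  have hz : ∀ α : Omni E L, pairing 0 α = 0 := fun α => by simp [pairing]
  have hm : ∀ (A : Der E L) (ψ : Jet E L), I.torsion (A, 0) (0, ψ) = 0 := fun A ψ => by
    refine eq_zero_of_pairing (fun B => ?_) (fun φ => ?_)
    · rw [pairing_torsion, hD, hz, neg_zero]
    -- The swap puts the jet ψ first, so that the exchange with φ produces the torsion of two jets.
    · rw [torsion_swap, pairing_neg_left, pairing_torsion, hJ, hz, neg_zero, neg_zero]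
  rintro ⟨A, φ⟩ ⟨B, ψ⟩
  have hs : ∀ (A : Der E L) (φ : Jet E L), ((A, φ) : Omni E L) = (A, 0) + (0, φ) := by simp
  rw [hs A, hs B, torsion_add_left, torsion_add_right, torsion_add_right, hD, hJ, hm,
    I.torsion_swap (0, φ), hm]
  simp

end GenAlmostContact
end Omni
end GeneralizedContact

/-! ### Reading off the four conditions. -/

open GeneralizedContact in
theorem mainTheorem3
    {E : Type*} [NormedAddCommGroup E] [NormedSpace ℝ E] [FiniteDimensional ℝ E]
    {M : Type*} [TopologicalSpace M] [T2Space M] [SecondCountableTopology M]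
    [ChartedSpace E M] [IsManifold 𝓘(ℝ, E) ∞ M]
    {L : M → Type*} [TopologicalSpace (Bundle.TotalSpace ℝ L)] [∀ x, TopologicalSpace (L x)]
    [FiberBundle ℝ L] [∀ x, AddCommGroup (L x)] [∀ x, Module ℝ (L x)] [VectorBundle ℝ ℝ L]
    [ContMDiffVectorBundle ∞ ℝ L 𝓘(ℝ, E)]
    (I : GenAlmostContact E L) :
    I.IsIntegrable ↔
      (∀ φ ψ : Jet E L, I.Jsharp (I.bracketJ φ ψ) = ⁅I.Jsharp φ, I.Jsharp ψ⁆) ∧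
      (∀ φ ψ : Jet E L, adj I.phi (I.bracketJ φ ψ) =
        lieDer (I.Jsharp φ) (adj I.phi ψ) - lieDer (I.Jsharp ψ) (adj I.phi φ)
          - dZero (I.J ![adj I.phi φ, ψ])) ∧
      (∀ A B : Der E L, torsionDer I.phi A B = I.Jsharp (contractThree (dTwo I.omega) A B)) ∧
      (∀ A B C : Der E L, dTwo I.omegaPhi ![A, B, C] =
        dTwo I.omega ![I.phi A, B, C] + dTwo I.omega ![A, I.phi B, C]
          + dTwo I.omega ![A, B, I.phi C]) := by 
  rw [I.isIntegrable_iff]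
  have hD : (∀ A B : Der E L, I.torsion (A, 0) (B, 0) = 0) ↔
      (∀ A B : Der E L, torsionDer I.phi A B = I.Jsharp (contractThree (dTwo I.omega) A B)) ∧
      (∀ A B C : Der E L, dTwo I.omegaPhi ![A, B, C] =
        dTwo I.omega ![I.phi A, B, C] + dTwo I.omega ![A, I.phi B, C]
          + dTwo I.omega ![A, B, I.phi C]) := by
    have h₁ : ∀ A B : Der E L, (I.torsion (A, 0) (B, 0)).1 =
        torsionDer I.phi A B - I.Jsharp (contractThree (dTwo I.omega) A B) := fun A B => by
      rw [I.torsion_der]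
    simp only [Prod.ext_iff, Prod.fst_zero, Prod.snd_zero, h₁, sub_eq_zero, LinearMap.ext_iff,
      I.torsion_der_snd_apply, LinearMap.zero_apply, forall_and]
    exact and_congr_right fun _ => forall₃_congr fun _ _ _ => eq_comm
  rw [hD]
  simp only [I.torsion_jet, Prod.mk_eq_zero, sub_eq_zero, forall_and, and_assoc]
  -- Only (C1) has its sides in the opposite order to the torsion component.
  exact and_congr_left fun _ => forall₂_congr fun _ _ => eq_comm
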